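/- Proposition 2.3. Let $\psi_\omega:\mathbb{R}^n\to\mathbb{R}$ be strictly convex, and let $\psi_0,\psi_1:\mathbb{R}^n\to\mathbb{R}$ be convex functions such that $\psi_0-\psi_\omega$ and $\psi_1-\psi_\omega$ are bounded. (This is the situation on a compact toric Kähler manifold $(M,\omega)$: there $\psi_\omega$ is the Kähler potential of $\omega$ on the open orbit in the coordinates $x=\mathrm{Re}\log z\in\mathbb{R}^n$, and $\psi_i(x)=\psi_\omega(x)+v_i(e^x)$ with $v_i$ a bounded torus-invariant $\omega$-plurisubharmonic function.) Consider the homogeneous real Monge–Ampère equation $$\mathrm{MA}\,\psi=0\ \text{ on } [0,1]\times\mathbb{R}^n,\qquad \psi(0,\cdot)=\psi_0,\quad \psi(1,\cdot)=\psi_1 .$$ A solution is a function $\psi:[0,1]\times\mathbb{R}^n\to\mathbb{R}$, convex in all variables $(s,x)$, whose Monge–Ampère measure in the sense of Alexandrov, $B\mapsto \mathrm{Leb}(\partial\psi(B))$, vanishes on $(0,1)\times\mathbb{R}^n$, and such that for every $x$ the function $s\mapsto\psi(s,x)$ is continuous on $[0,1]$ with $\psi(0,x)=\psi_0(x)$ and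 $\psi(1,x)=\psi_1(x)$. Then a solution $\psi$ with $\psi(s,x)-\psi_\omega(x)$ bounded on $[0,1]\times\mathbb{R}^n$ exists, and every solution is given by $$\psi(s,x)=\sup_{\sigma\in\mathbb{R}}\Big[\min\{\psi_0,\psi_1-\sigma\}^{\star\star}(x)+s\sigma\Big],\qquad (s,x)\in[0,1]\times\mathbb{R}^n$$ (in particular the solution is unique). Here $f^{\star}(y)=\sup_{x\in\mathbb{R}^n}[\langle x,y\rangle-f(x)]\in[-\infty,\infty]$ is the Legendre transform in the $\mathbb{R}^n$ variables, so that $f^{\star\star}$ is the convexification of $f$ in $x$. -/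

import Mathlib

open Set MeasureTheory

noncomputable section

/-- The closed strip `[0,1] × ℝⁿ`, with variables `(s, x)`. -/
def closedStrip (n : ℕ) : Set (ℝ × EuclideanSpace ℝ (Fin n)) :=
  Icc (0 : ℝ) 1 ×ˢ univ

/-- The open strip `(0,1) × ℝⁿ`. -/
def openStrip (n : ℕ) : Set (ℝ × EuclideanSpace ℝ (Fin n)) :=
  Ioo (0 : ℝ) 1 ×ˢ univ

/-- The subdifferential at `p = (s, x)` of a function `u` on a set `Ω ⊆ ℝ × ℝⁿ`: all slopes
`q = (τ, y)` such that the affine function of slope `q` which agrees with `u` at `p` lies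
below `u` on all of `Ω`. -/
def subdifferentialOn {n : ℕ} (Ω : Set (ℝ × EuclideanSpace ℝ (Fin n)))
    (u : ℝ × EuclideanSpace ℝ (Fin n) → ℝ) (p : ℝ × EuclideanSpace ℝ (Fin n)) :
    Set (ℝ × EuclideanSpace ℝ (Fin n)) :=
  {q | ∀ p' ∈ Ω, u p + q.1 * (p'.1 - p.1) + inner ℝ q.2 (p'.2 - p.2) ≤ u p'}

/-- The real Monge–Ampère mass of a Borel set `B ⊆ Ω`, for a convex function `u` on an open convex
set `Ω ⊆ ℝ × ℝⁿ`, in the sense of Alexandrov: the Lebesgue measure of the set of all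
subgradients of `u` at points of `B`. For `u` of class `C²` this is `∫_B det D²u`, and it is the
continuous extension of the latter to all convex functions. -/
def mongeAmpere {n : ℕ} (Ω : Set (ℝ × EuclideanSpace ℝ (Fin n)))
    (u : ℝ × EuclideanSpace ℝ (Fin n) → ℝ) (B : Set (ℝ × EuclideanSpace ℝ (Fin n))) : ENNReal :=
  volume (⋃ p ∈ B, subdifferentialOn Ω u p)

/-- `ψ` is a (weak) solution of the homogeneous real Monge–Ampère equation on `[0,1] × ℝⁿ`
with endpoints `ψ₀` and `ψ₁`: it is convex in all variables, its Monge–Ampère measure vanishes in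
the open strip, and for each `x` the function `ψ(·, x)` is continuous up to the
boundary of `[0,1]` with boundary values `ψ₀ x` and `ψ₁ x`. -/
structure IsHRMASolution {n : ℕ} (ψ₀ ψ₁ : EuclideanSpace ℝ (Fin n) → ℝ)
    (ψ : ℝ × EuclideanSpace ℝ (Fin n) → ℝ) : Prop where
  convexOn : ConvexOn ℝ (closedStrip n) ψ
  mongeAmpere_eq_zero : ∀ B : Set (ℝ × EuclideanSpace ℝ (Fin n)), MeasurableSet B →
    B ⊆ openStrip n → mongeAmpere (openStrip n) ψ B = 0
  continuousOn : ∀ x, ContinuousOn (fun s : ℝ => ψ (s, x)) (Icc 0 1)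
  left_endpoint : ∀ x, ψ (0, x) = ψ₀ x
  right_endpoint : ∀ x, ψ (1, x) = ψ₁ x

/-- The Legendre transform in the `ℝⁿ` variables, `f⋆(y) = sup_x [⟨x, y⟩ - f(x)]`, with values
in `[-∞, ∞]`. -/
def legendre {n : ℕ} (f : EuclideanSpace ℝ (Fin n) → EReal) (y : EuclideanSpace ℝ (Fin n)) :
    EReal :=
  ⨆ x : EuclideanSpace ℝ (Fin n), ((inner ℝ x y : ℝ) : EReal) - f x

/-- The rooftop envelope `min{ψ₀, ψ₁ - σ}⋆⋆`: the convexification in `x`, by a double Legendre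
transform. -/
def rooftopEnvelope {n : ℕ} (ψ₀ ψ₁ : EuclideanSpace ℝ (Fin n) → ℝ) (σ : ℝ) :
    EuclideanSpace ℝ (Fin n) → EReal :=
  legendre (legendre fun x => ((min (ψ₀ x) (ψ₁ x - σ) : ℝ) : EReal))

/-- The negative Legendre transform in the variable dual to `s`,
`g⋆(s) = sup_σ [g(σ) + s σ]`, with values in `[-∞, ∞]`. -/
def negLegendre (g : ℝ → EReal) (s : ℝ) : EReal :=
  ⨆ σ : ℝ, g σ + ((s * σ : ℝ) : EReal)

end

/-!
A solution has to be the supremum of the affine functions lying below the boundary data at `s = 0`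
and `s = 1`; grouping these by their slope `σ` in `s` gives the formula.

A convex function is such a supremum of those lying below its own boundary values, so one must show
that every affine minorant of the boundary data lies below the solution `ψ`. If a minorant of slope
`q` leaves room `ε ‖x‖`, the difference of `ψ` and the minorant attains its minimum over the strip,
either on the boundary, where it is nonnegative, or at an interior point, where `q` is then a
subgradient of `ψ`. The subgradients form a null set, so `q` can be moved slightly to avoid them.
Linear growth of `ψ₀` and `ψ₁`, which strict convexity of `ψω` provides, means that minorants with
such room exist, and mixing a little of one of them into an arbitrary minorant gives it room.

Conversely, the supremum of the minorants is a solution: a minorant of slope `(τ, y)` that touches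
it at an interior point is also the best one of spatial slope `y` at both ends, so
`τ = ψ₀⋆(y) - ψ₁⋆(y)`. Hence the subgradients lie in the graph of a measurable function, which is a
null set.
-/

open Filter Topology

section ConvexStrip

theorem interior_Icc_prod_univ {X : Type*} [TopologicalSpace X] :
    interior (Icc (0 : ℝ) 1 ×ˢ (univ : Set X)) = Ioo 0 1 ×ˢ univ := by
  rw [interior_prod_eq, interior_Icc, interior_univ]

variable {E : Type*} [NormedAddCommGroup E] [NormedSpace ℝ E] [FiniteDimensional ℝ E]

theorem lowerSemicontinuousWithinAt_of_convexOn {C : Set E} {u : E → ℝ} {w z : E}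
    (hu : ConvexOn ℝ C u) (hw : w ∈ C) (hz : z ∈ interior C)
    (hlim : Tendsto (fun t : ℝ => u (AffineMap.lineMap w z t)) (𝓝[>] 0) (𝓝 (u w))) :
    LowerSemicontinuousWithinAt u C w := by
  intro r hr
  have hhalf : Tendsto (fun t : ℝ => t / 2) (𝓝[>] 0) (𝓝[>] 0) :=
    tendsto_nhdsWithin_iff.2 ⟨tendsto_nhdsWithin_of_tendsto_nhds
      ((continuous_id.div_const 2).tendsto' 0 0 (by simp)),
      eventually_mem_nhdsWithin.mono fun t ht => half_pos (mem_Ioi.1 ht)⟩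
  have hextrap : Tendsto (fun t : ℝ => 2 * u (AffineMap.lineMap w z (t / 2))
      - u (AffineMap.lineMap w z t)) (𝓝[>] 0) (𝓝 (u w)) := by
    simpa [two_mul] using ((hlim.comp hhalf).const_mul 2).sub hlim
  obtain ⟨t, hrt, ht⟩ :=
    ((hextrap.eventually_const_lt hr).and (Ioo_mem_nhdsGT zero_lt_one)).exists
  have hline : ∀ t ∈ Ioo (0 : ℝ) 1, AffineMap.lineMap w z t ∈ interior C := fun t ht => by
    rw [AffineMap.lineMap_apply_module', add_comm]
    exact hu.1.add_smul_sub_mem_interior hw hz (Ioo_subset_Ioc_self ht)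
  set m := AffineMap.lineMap w z t
  have hmid : (1 / 2 : ℝ) • w + (1 / 2 : ℝ) • m = AffineMap.lineMap w z (t / 2) := by
    simp only [m, AffineMap.lineMap_apply_module']
    module
  have hmidC : (1 / 2 : ℝ) • w + (1 / 2 : ℝ) • m ∈ interior C :=
    hmid ▸ hline _ ⟨half_pos ht.1, by linarith [ht.2]⟩
  have hcont : ContinuousAt (fun q => u ((1 / 2 : ℝ) • q + (1 / 2 : ℝ) • m)) w :=
    (hu.continuousOn_interior.continuousAt (isOpen_interior.mem_nhds hmidC)).comp
      (f := fun q => (1 / 2 : ℝ) • q + (1 / 2 : ℝ) • m) (by fun_prop)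
  have hgap : (r + u m) / 2 < u ((1 / 2 : ℝ) • w + (1 / 2 : ℝ) • m) := by rw [hmid]; linarith
  filter_upwards [mem_nhdsWithin_of_mem_nhds (hcont.eventually_const_lt hgap),
    self_mem_nhdsWithin] with q hq hqC
  have hconv := hu.2 hqC (interior_subset (hline t ht)) one_half_pos.le one_half_pos.le
    (add_halves (1 : ℝ))
  simp only [smul_eq_mul] at hconv
  linarith

variable {u : ℝ × E → ℝ} (hu : ConvexOn ℝ (Icc 0 1 ×ˢ univ) u)

include hu in
theorem lowerSemicontinuousOn_strip (hslice : ∀ x, ContinuousOn (fun s => u (s, x)) (Icc 0 1)) :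
    LowerSemicontinuousOn u (Icc 0 1 ×ˢ univ) := by
  rintro ⟨s, x⟩ hp
  refine lowerSemicontinuousWithinAt_of_convexOn (z := (1 / 2, x)) hu hp
    (by rw [interior_Icc_prod_univ]; norm_num) ?_
  have hline : Tendsto (AffineMap.lineMap s (1 / 2 : ℝ) : ℝ → ℝ) (𝓝[>] 0) (𝓝[Icc 0 1] s) := by
    refine tendsto_nhdsWithin_iff.2 ⟨tendsto_nhdsWithin_of_tendsto_nhds
      (AffineMap.lineMap_continuous.tendsto' 0 s (by simp)), ?_⟩
    filter_upwards [Ioo_mem_nhdsGT zero_lt_one] with t ht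
    exact (convex_Icc 0 1).lineMap_mem hp.1 (by norm_num) (Ioo_subset_Icc_self ht)
  convert (hslice x s hp.1).tendsto.comp hline using 2 with t
  simp [AffineMap.lineMap_apply]

include hu in
theorem isBounded_sublevel_strip (hlsc : LowerSemicontinuousOn u (Icc 0 1 ×ˢ univ))
    (hcoer : Tendsto (fun x => u (0, x)) (Bornology.cobounded E) atTop) (m : ℝ) :
    Bornology.IsBounded {p ∈ Icc 0 1 ×ˢ univ | u p ≤ m} := by
  obtain ⟨M, hM₀, hmM⟩ : ∃ M, u 0 ≤ M ∧ m ≤ M := ⟨_, le_max_left _ _, le_max_right _ _⟩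
  obtain ⟨T, hTpos, hT⟩ : ∃ T > 0, ∀ x : E, T ≤ ‖x‖ → M < u (0, x) := by
    obtain ⟨T, -, hT⟩ := (hasBasis_cobounded_norm.eventually_iff).1 (hcoer.eventually_gt_atTop M)
    exact ⟨max T 1, by positivity, fun x hx => hT (le_of_max_le_left hx)⟩
  have hcompact : IsCompact {p ∈ Icc 0 1 ×ˢ Metric.sphere (0 : E) T | u p ≤ M} :=
    (hlsc.mono (prod_mono_right (subset_univ _))).isCompact_inter_preimage_Iic
      (isCompact_Icc.prod (isCompact_sphere 0 T)) M
  obtain ⟨δ, hδ, hδ_le⟩ := hcompact.exists_forall_le' (f := Prod.fst) (a := (0 : ℝ))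
    continuousOn_fst fun p hp => hp.1.1.1.lt_of_ne' fun hp₀ => by
      have := hT p.2 (by simpa using hp.1.2.ge)
      rw [← hp₀] at this
      exact this.not_ge hp.2
  refine (Metric.isBounded_Icc 0 1 |>.prod
    (Metric.isBounded_closedBall (x := (0 : E)) (r := max T (T / δ)))).subset ?_
  rintro ⟨s, x⟩ ⟨⟨hs, -⟩, hq⟩
  refine ⟨hs, mem_closedBall_zero_iff.2 ?_⟩
  rcases le_total ‖x‖ T with hx | hx
  · exact hx.trans (le_max_left _ _)
  refine le_max_of_le_right ((le_div_iff₀' hδ).2 ?_)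
  have hxpos : 0 < ‖x‖ := hTpos.trans_le hx
  have hc : T / ‖x‖ ∈ Icc (0 : ℝ) 1 := ⟨by positivity, (div_le_one hxpos).2 hx⟩
  have hradial : (T / ‖x‖) • (s, x) ∈ {p ∈ Icc 0 1 ×ˢ univ | u p ≤ M} :=
    (hu.convex_le M).smul_mem_of_zero_mem ⟨by simp, hM₀⟩ ⟨⟨hs, trivial⟩, hq.trans hmM⟩ hc
  have hle : δ ≤ T / ‖x‖ * s := hδ_le ((T / ‖x‖) • (s, x) : ℝ × E)
    ⟨⟨hradial.1.1, by simp [norm_smul, hxpos.ne', abs_of_pos hTpos]⟩, hradial.2⟩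
  exact (le_div_iff₀ hxpos).1 (hle.trans (mul_le_of_le_one_right hc.1 hs.2))

include hu in
theorem exists_isMinOn_strip (hslice : ∀ x, ContinuousOn (fun s => u (s, x)) (Icc 0 1))
    (hcoer : Tendsto (fun x => u (0, x)) (Bornology.cobounded E) atTop) :
    ∃ p ∈ Icc (0 : ℝ) 1 ×ˢ (univ : Set E), IsMinOn u (Icc 0 1 ×ˢ univ) p := by
  have hlsc := lowerSemicontinuousOn_strip hu hslice
  obtain ⟨R, hR⟩ := (isBounded_sublevel_strip hu hlsc hcoer (u 0)).subset_closedBall 0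
  have hzero : (0 : ℝ × E) ∈ Icc (0 : ℝ) 1 ×ˢ (univ : Set E) ∩ Metric.closedBall 0 R :=
    ⟨by simp, hR ⟨by simp, le_rfl⟩⟩
  have hcompact : IsCompact (Icc 0 1 ×ˢ univ ∩ Metric.closedBall (0 : ℝ × E) R) :=
    (isCompact_closedBall _ _).inter_left (isClosed_Icc.prod isClosed_univ)
  obtain ⟨p, hp, hmin⟩ := (hlsc.mono inter_subset_left).exists_isMinOn ⟨0, hzero⟩ hcompact
  refine ⟨p, hp.1, fun q hq => ?_⟩
  rcases le_total (u q) (u 0) with h | h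
  · exact hmin ⟨hq, hR ⟨hq, h⟩⟩
  · exact (hmin hzero).trans h

end ConvexStrip

section LinearGrowth

variable {E : Type*} [NormedAddCommGroup E] [InnerProductSpace ℝ E] {f g : E → ℝ}

/-- `f` dominates an affine function plus a positive multiple of the norm; equivalently, the
Legendre transform of `f` is bounded above near some `y`. -/
def GrowsLinearly (f : E → ℝ) : Prop :=
  ∃ (a : ℝ) (y : E), ∃ ε > 0, ∀ x, a + inner ℝ y x + ε * ‖x‖ ≤ f x

theorem GrowsLinearly.of_abs_sub_le {C : ℝ} (hg : GrowsLinearly g) (h : ∀ x, |f x - g x| ≤ C) :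
    GrowsLinearly f := by
  obtain ⟨a, y, ε, hε, hle⟩ := hg
  exact ⟨a - C, y, ε, hε, fun x => by linarith [hle x, (abs_le.1 (h x)).1]⟩

theorem tendsto_sub_inner_atTop {b ε : ℝ} {y : E} (hε : 0 < ε)
    (h : ∀ x, b + inner ℝ y x + ε * ‖x‖ ≤ f x) :
    Tendsto (fun x => f x - inner ℝ y x) (Bornology.cobounded E) atTop := by
  refine tendsto_atTop_mono (fun x => ?_)
    (tendsto_atTop_add_const_left _ b (tendsto_norm_cobounded_atTop.const_mul_atTop hε))
  linarith [h x]

variable [FiniteDimensional ℝ E]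

theorem exists_inner_add_le_of_lt (hf : ConvexOn ℝ univ f) {x : E} {r : ℝ} (hr : r < f x) :
    ∃ (a : ℝ) (y : E), (∀ x', a + inner ℝ y x' ≤ f x') ∧ a + inner ℝ y x = r := by
  obtain ⟨l, a, hle, hval⟩ := hf.exists_affine_le_of_lt (𝕜 := ℝ) (mem_univ x) hr isClosed_univ
    (hf.locallyLipschitz.continuous.lowerSemicontinuous.lowerSemicontinuousOn _)
  refine ⟨a, (InnerProductSpace.toDual ℝ E).symm l, fun x' => ?_, ?_⟩
  · simpa [add_comm] using hle ⟨x', mem_univ x'⟩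
  · simpa [add_comm] using hval

theorem exists_pos_forall_le_convexity_gap (hf : StrictConvexOn ℝ univ f) :
    ∃ δ > 0, ∀ x ∈ Metric.sphere (0 : E) 1, δ ≤ (f 0 + f x) / 2 - f ((1 / 2 : ℝ) • x) := by
  have hcont : Continuous f := hf.convexOn.locallyLipschitz.continuous
  refine (isCompact_sphere (0 : E) 1).exists_forall_le' (by fun_prop) fun x hx => ?_
  have hgap := hf.2 (mem_univ 0) (mem_univ x)
    (ne_zero_of_mem_unit_sphere (⟨x, hx⟩ : Metric.sphere (0 : E) 1)).symm
    one_half_pos one_half_pos (add_halves (1 : ℝ))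
  simp only [smul_zero, zero_add, smul_eq_mul] at hgap
  linarith

theorem growsLinearly_of_strictConvexOn (hf : StrictConvexOn ℝ univ f) : GrowsLinearly f := by
  obtain ⟨δ, hδ, hgap⟩ := exists_pos_forall_le_convexity_gap hf
  obtain ⟨a, y, hle, hzero⟩ :=
    exists_inner_add_le_of_lt hf.convexOn (sub_lt_self (f 0) (half_pos hδ))
  rw [inner_zero_right, add_zero] at hzero
  refine ⟨a - δ, y, δ, hδ, fun x => ?_⟩
  rcases le_total ‖x‖ 1 with hx | hx
  · linarith [hle x, mul_le_of_le_one_right hδ.le hx]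
  have hxpos : 0 < ‖x‖ := one_pos.trans_le hx
  have hsphere := hgap (‖x‖⁻¹ • x) (by simp [norm_smul, hxpos.ne'])
  have hmid := hle ((1 / 2 : ℝ) • ‖x‖⁻¹ • x)
  have hconv := hf.convexOn.2 (mem_univ 0) (mem_univ x)
    (sub_nonneg.2 (inv_le_one_of_one_le₀ hx)) (inv_pos.2 hxpos).le (sub_add_cancel _ _)
  simp only [smul_zero, zero_add, inner_smul_right, smul_eq_mul] at hmid hconv
  have hradial : δ ≤ ‖x‖⁻¹ * (f x - a - inner ℝ y x) := by
    subst hzero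
    linarith [mul_pos (inv_pos.2 hxpos) hδ]
  rw [inv_mul_eq_div, le_div_iff₀ hxpos] at hradial
  linarith

end LinearGrowth

section AffineMinorants

variable {E : Type*} [NormedAddCommGroup E] [InnerProductSpace ℝ E] {ψ₀ ψ₁ : E → ℝ} {a b C : ℝ}
  {q q' p : ℝ × E}

/-- The pairing `⟨(τ, y), (s, x)⟩ = τ s + ⟨y, x⟩` of a slope with a point. It is introduced by hand
because the norm of the product type `ℝ × E` does not come from an inner product. -/
noncomputable def pairing (q : ℝ × E) : ℝ × E →L[ℝ] ℝ :=
  (ContinuousLinearMap.mul ℝ ℝ q.1).coprod (innerSL ℝ q.2)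

theorem pairing_apply (q p : ℝ × E) : pairing q p = q.1 * p.1 + inner ℝ q.2 p.2 := by
  simp [pairing]

theorem exists_pairing_eq [CompleteSpace E] (l : ℝ × E →L[ℝ] ℝ) : ∃ q, pairing q = l := by
  refine ⟨(l (1, 0), (InnerProductSpace.toDual ℝ E).symm (l.comp (.inr ℝ ℝ E))), ?_⟩
  ext <;> simp [pairing]

/-- The affine function `p ↦ a + ⟨q, p⟩` on `ℝ × E` lies below `ψ₀` on `{0} × E` and below `ψ₁` on
`{1} × E`. -/
structure IsAffineMinorant (ψ₀ ψ₁ : E → ℝ) (a : ℝ) (q : ℝ × E) : Prop where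
  left : ∀ x, a + inner ℝ q.2 x ≤ ψ₀ x
  right : ∀ x, a + q.1 + inner ℝ q.2 x ≤ ψ₁ x

theorem IsAffineMinorant.le_chord (h : IsAffineMinorant ψ₀ ψ₁ a q) {s : ℝ} (hs : s ∈ Icc 0 1)
    (x : E) : a + pairing q (s, x) ≤ (1 - s) * ψ₀ x + s * ψ₁ x := by
  have h₀ := mul_le_mul_of_nonneg_left (h.left x) (sub_nonneg.2 hs.2)
  have h₁ := mul_le_mul_of_nonneg_left (h.right x) hs.1
  rw [pairing_apply]
  linarith

theorem IsAffineMinorant.smul_add_smul {φ₀ φ₁ : E → ℝ} (h : IsAffineMinorant ψ₀ ψ₁ a q)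
    (h' : IsAffineMinorant φ₀ φ₁ b q') {s t : ℝ} (hs : 0 ≤ s) (ht : 0 ≤ t) :
    IsAffineMinorant (s • ψ₀ + t • φ₀) (s • ψ₁ + t • φ₁) (s * a + t * b) (s • q + t • q') := by
  constructor <;> intro x <;>
    simp only [Pi.add_apply, Pi.smul_apply, Prod.fst_add, Prod.snd_add, Prod.smul_fst,
      Prod.smul_snd, smul_eq_mul, inner_add_left, real_inner_smul_left]
  · linarith [mul_le_mul_of_nonneg_left (h.left x) hs, mul_le_mul_of_nonneg_left (h'.left x) ht]
  · linarith [mul_le_mul_of_nonneg_left (h.right x) hs, mul_le_mul_of_nonneg_left (h'.right x) ht]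

theorem IsAffineMinorant.perturb_slope {ε : ℝ}
    (h : IsAffineMinorant (fun x => ψ₀ x - ε * ‖x‖) (fun x => ψ₁ x - ε * ‖x‖) a q) (q' : ℝ × E) :
    IsAffineMinorant (fun x => ψ₀ x - (ε - ‖q' - q‖) * ‖x‖)
      (fun x => ψ₁ x - (ε - ‖q' - q‖) * ‖x‖) (a - ‖q' - q‖) q' := by
  have hinner : ∀ x, inner ℝ q'.2 x ≤ inner ℝ q.2 x + ‖q' - q‖ * ‖x‖ := fun x => by
    rw [← sub_le_iff_le_add', ← inner_sub_left]
    exact (real_inner_le_norm _ _).trans (by gcongr; exact norm_snd_le (q' - q))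
  have hfst : q'.1 - q.1 ≤ ‖q' - q‖ := (le_abs_self _).trans (norm_fst_le (q' - q))
  exact ⟨fun x => by linarith [h.left x, hinner x, norm_nonneg (q' - q)],
    fun x => by linarith [h.right x, hinner x]⟩

theorem IsAffineMinorant.swap (h : IsAffineMinorant ψ₀ ψ₁ a q) :
    IsAffineMinorant ψ₁ ψ₀ (a + q.1) (-q.1, q.2) :=
  ⟨h.right, by simpa using h.left⟩

theorem GrowsLinearly.exists_isAffineMinorant (h₀ : GrowsLinearly ψ₀)
    (hC : ∀ x, ψ₀ x - ψ₁ x ≤ C) :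
    ∃ ε > 0, ∃ a q, IsAffineMinorant (fun x => ψ₀ x - ε * ‖x‖) (fun x => ψ₁ x - ε * ‖x‖) a q := by
  obtain ⟨a, y, ε, hε, hle⟩ := h₀
  exact ⟨ε, hε, a, (-C, y), fun x => by linarith [hle x], fun x => by linarith [hle x, hC x]⟩

theorem isAffineMinorant_of_forall_le {u : ℝ × E → ℝ}
    (hslice : ∀ x, ContinuousOn (fun s => u (s, x)) (Icc 0 1))
    (hle : ∀ p ∈ Ioo (0 : ℝ) 1 ×ˢ univ, a + pairing q p ≤ u p) :
    IsAffineMinorant (fun x => u (0, x)) (fun x => u (1, x)) a q := by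
  have hclosed : ∀ x, ∀ s ∈ Icc (0 : ℝ) 1, a + pairing q (s, x) ≤ u (s, x) := fun x => by
    rw [← closure_Ioo (zero_ne_one' ℝ)] at hslice ⊢
    exact fun s hs => le_on_closure (fun s hs => hle (s, x) ⟨hs, trivial⟩)
      (by fun_prop) (hslice x) hs
  exact ⟨fun x => by simpa [pairing_apply] using hclosed x 0 (by simp),
    fun x => by simpa [pairing_apply, add_assoc] using hclosed x 1 (by simp)⟩

/-- The values at `p` of the affine functions lying below `ψ₀` on `{0} × E` and below `ψ₁` on
`{1} × E`. -/
def minorantValues (ψ₀ ψ₁ : E → ℝ) (p : ℝ × E) : Set ℝ :=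
  {r | ∃ a q, IsAffineMinorant ψ₀ ψ₁ a q ∧ a + pairing q p = r}

theorem minorantValues_swap (s : ℝ) (x : E) :
    minorantValues ψ₁ ψ₀ (1 - s, x) = minorantValues ψ₀ ψ₁ (s, x) := by
  have hsubset : ∀ (φ₀ φ₁ : E → ℝ) (t : ℝ),
      minorantValues φ₀ φ₁ (t, x) ⊆ minorantValues φ₁ φ₀ (1 - t, x) := by
    rintro φ₀ φ₁ t _ ⟨a, q, h, rfl⟩
    exact ⟨_, _, h.swap, by simp only [pairing_apply]; ring⟩
  exact Subset.antisymm (by simpa using hsubset ψ₁ ψ₀ (1 - s)) (hsubset ψ₀ ψ₁ s)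

variable [FiniteDimensional ℝ E]

theorem sub_mul_mem_minorantValues (h₀ : ConvexOn ℝ univ ψ₀) (hC : ∀ x, ψ₀ x - ψ₁ x ≤ C) {x : E}
    {r : ℝ} (hr : r < ψ₀ x) (s : ℝ) : r - s * C ∈ minorantValues ψ₀ ψ₁ (s, x) := by
  obtain ⟨a, y, hle, hval⟩ := exists_inner_add_le_of_lt h₀ hr
  refine ⟨a, (-C, y), ⟨hle, fun x' => ?_⟩, ?_⟩
  · linarith [hle x', hC x']
  · rw [pairing_apply, ← hval]
    ring

theorem mem_minorantValues_of_lt {u : ℝ × E → ℝ} (hu : ConvexOn ℝ (Icc 0 1 ×ˢ univ) u)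
    (hslice : ∀ x, ContinuousOn (fun s => u (s, x)) (Icc 0 1)) (hp : p ∈ Icc 0 1 ×ˢ univ) {r : ℝ}
    (hr : r < u p) : r ∈ minorantValues (fun x => u (0, x)) (fun x => u (1, x)) p := by
  obtain ⟨l, a, hle, hval⟩ := hu.exists_affine_le_of_lt (𝕜 := ℝ) hp hr
    (isClosed_Icc.prod isClosed_univ) (lowerSemicontinuousOn_strip hu hslice)
  obtain ⟨q, rfl⟩ := exists_pairing_eq l
  refine ⟨a, q, isAffineMinorant_of_forall_le hslice fun p hp => ?_, by rw [add_comm]; exact hval⟩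
  simpa [add_comm] using hle ⟨p, prod_mono_left Ioo_subset_Icc_self hp⟩

end AffineMinorants

section Comparison

variable {n : ℕ} {ψ₀ ψ₁ : EuclideanSpace ℝ (Fin n) → ℝ} {ψ : ℝ × EuclideanSpace ℝ (Fin n) → ℝ}
  {a ε C : ℝ} {p q : ℝ × EuclideanSpace ℝ (Fin n)}

theorem mem_subdifferentialOn_iff {Ω : Set (ℝ × EuclideanSpace ℝ (Fin n))} :
    q ∈ subdifferentialOn Ω ψ p ↔ ∀ p' ∈ Ω, ψ p - pairing q p ≤ ψ p' - pairing q p' := by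
  refine forall₂_congr fun p' _ => ?_
  rw [pairing_apply, pairing_apply, inner_sub_right]
  constructor <;> intro h <;> linarith

theorem IsAffineMinorant.le_of_notMem_subdifferentialOn (hψ : ConvexOn ℝ (closedStrip n) ψ)
    (hslice : ∀ x, ContinuousOn (fun s => ψ (s, x)) (Icc 0 1))
    (h : IsAffineMinorant (fun x => ψ (0, x)) (fun x => ψ (1, x)) a q)
    (hcoer : Tendsto (fun x => ψ (0, x) - inner ℝ q.2 x) (Bornology.cobounded _) atTop)
    (hq : ∀ p ∈ openStrip n, q ∉ subdifferentialOn (openStrip n) ψ p) (hp : p ∈ closedStrip n) :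
    a + pairing q p ≤ ψ p := by
  obtain ⟨⟨s, x⟩, hs, hmin⟩ := exists_isMinOn_strip (u := fun p => ψ p - pairing q p)
    (hψ.sub ((pairing q).toLinearMap.concaveOn hψ.1))
    (fun x => (hslice x).sub (by fun_prop)) (by simpa [pairing_apply] using hcoer)
  suffices hsx : a + pairing q (s, x) ≤ ψ (s, x) by linarith [isMinOn_iff.1 hmin p hp]
  rcases hs.1.1.eq_or_lt with rfl | hs₀
  · simpa [pairing_apply] using h.left x
  rcases hs.1.2.eq_or_lt with rfl | hs₁
  · simpa [pairing_apply, add_assoc] using h.right x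
  · refine absurd (mem_subdifferentialOn_iff.2 fun p' hp' => ?_) (hq (s, x) ⟨⟨hs₀, hs₁⟩, trivial⟩)
    exact isMinOn_iff.1 hmin p' (prod_mono_left Ioo_subset_Icc_self hp')

namespace IsHRMASolution

theorem dense_notMem_subdifferentialOn (hψ : IsHRMASolution ψ₀ ψ₁ ψ) :
    Dense {q | ∀ p ∈ openStrip n, q ∉ subdifferentialOn (openStrip n) ψ p} := by
  have hnull := hψ.mongeAmpere_eq_zero (openStrip n)
    (measurableSet_Ioo.prod MeasurableSet.univ) Subset.rfl
  convert interior_eq_empty_iff_dense_compl.1 (Measure.interior_eq_empty_of_null hnull) using 1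
  ext q
  simp

theorem minorant_le_of_growth (hψ : IsHRMASolution ψ₀ ψ₁ ψ) (hε : 0 < ε)
    (h : IsAffineMinorant (fun x => ψ₀ x - ε * ‖x‖) (fun x => ψ₁ x - ε * ‖x‖) a q)
    (hp : p ∈ closedStrip n) : a + pairing q p ≤ ψ p := by
  have hlim : Tendsto (fun q' => a - ‖q' - q‖ + pairing q' p) (𝓝 q) (𝓝 (a + pairing q p)) := by
    simp only [pairing_apply]
    exact Continuous.tendsto' (by fun_prop) _ _ (by simp)
  have hfreq := mem_closure_iff_frequently.1 (hψ.dense_notMem_subdifferentialOn q)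
  refine le_of_tendsto_of_frequently hlim
    ((hfreq.and_eventually (Metric.ball_mem_nhds q hε)).mono fun q' ⟨hq', hdist⟩ => ?_)
  have hε' : 0 < ε - ‖q' - q‖ := sub_pos.2 (mem_ball_iff_norm.1 hdist)
  have h' := h.perturb_slope q'
  have hmin : IsAffineMinorant (fun x => ψ (0, x)) (fun x => ψ (1, x)) (a - ‖q' - q‖) q' := by
    simp only [hψ.left_endpoint, hψ.right_endpoint]
    exact ⟨fun x => by linarith [h'.left x, mul_nonneg hε'.le (norm_nonneg x)],
      fun x => by linarith [h'.right x, mul_nonneg hε'.le (norm_nonneg x)]⟩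
  refine hmin.le_of_notMem_subdifferentialOn hψ.convexOn hψ.continuousOn ?_ hq' hp
  simp only [hψ.left_endpoint]
  exact tendsto_sub_inner_atTop (b := a - ‖q' - q‖) hε' fun x => by linarith [h'.left x]

theorem minorant_le (hψ : IsHRMASolution ψ₀ ψ₁ ψ) (hg : GrowsLinearly ψ₀)
    (hC : ∀ x, ψ₀ x - ψ₁ x ≤ C) (h : IsAffineMinorant ψ₀ ψ₁ a q) (hp : p ∈ closedStrip n) :
    a + pairing q p ≤ ψ p := by
  obtain ⟨ε, hε, b, q', h'⟩ := hg.exists_isAffineMinorant hC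
  have hlim : Tendsto (fun t : ℝ => (1 - t) * a + t * b + pairing ((1 - t) • q + t • q') p)
      (𝓝[>] 0) (𝓝 (a + pairing q p)) := by
    simp only [pairing_apply]
    exact tendsto_nhdsWithin_of_tendsto_nhds (Continuous.tendsto' (by fun_prop) _ _ (by simp))
  refine le_of_tendsto hlim ?_
  filter_upwards [Ioo_mem_nhdsGT one_pos] with t ht
  refine hψ.minorant_le_of_growth (mul_pos ht.1 hε) ?_ hp
  convert h.smul_add_smul h' (sub_nonneg.2 ht.2.le) ht.1.le using 1 <;>
    (ext x; simp only [Pi.add_apply, Pi.smul_apply, smul_eq_mul]; ring)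

theorem isLUB_minorantValues (hψ : IsHRMASolution ψ₀ ψ₁ ψ) (hg : GrowsLinearly ψ₀)
    (hC : ∀ x, ψ₀ x - ψ₁ x ≤ C) (hp : p ∈ closedStrip n) :
    IsLUB (minorantValues ψ₀ ψ₁ p) (ψ p) := by
  refine ⟨?_, fun b hb => le_of_forall_lt_imp_le_of_dense fun r hr => hb ?_⟩
  · rintro _ ⟨a, q, h, rfl⟩
    exact hψ.minorant_le hg hC h hp
  · simpa only [hψ.left_endpoint, hψ.right_endpoint] using
      mem_minorantValues_of_lt hψ.convexOn hψ.continuousOn hp hr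

end IsHRMASolution

end Comparison

section Legendre

variable {n : ℕ} {f ψ₀ ψ₁ : EuclideanSpace ℝ (Fin n) → ℝ} {a b c : ℝ}
  {p q : ℝ × EuclideanSpace ℝ (Fin n)}

theorem legendre_coe_le_coe_iff {y : EuclideanSpace ℝ (Fin n)} :
    legendre (fun x => (f x : EReal)) y ≤ c ↔ ∀ x, inner ℝ y x - c ≤ f x := by
  refine iSup_le_iff.trans (forall_congr' fun x => ?_)
  rw [← EReal.coe_sub, EReal.coe_le_coe_iff, real_inner_comm, sub_le_comm]

theorem measurable_legendre_coe (f : EuclideanSpace ℝ (Fin n) → ℝ) :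
    Measurable (legendre fun x => (f x : EReal)) := by
  refine LowerSemicontinuous.measurable (lowerSemicontinuous_iSup fun x => ?_)
  simp only [← EReal.coe_sub]
  exact (continuous_coe_real_ereal.comp (by fun_prop)).lowerSemicontinuous

theorem isAffineMinorant_iff_legendre_min_le :
    IsAffineMinorant ψ₀ ψ₁ a q ↔
      legendre (fun x => ((min (ψ₀ x) (ψ₁ x - q.1) : ℝ) : EReal)) q.2 ≤ (-a : ℝ) := by
  rw [legendre_coe_le_coe_iff]
  simp only [le_min_iff, forall_and]
  exact ⟨fun h => ⟨fun x => by linarith [h.left x], fun x => by linarith [h.right x]⟩,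
    fun h => ⟨fun x => by linarith [h.1 x], fun x => by linarith [h.2 x]⟩⟩

theorem coe_sub_le_coe_iff {t : ℝ} {m : EReal} :
    (t : EReal) - m ≤ b ↔ ((t - b : ℝ) : EReal) ≤ m := by
  induction m with
  | bot => simp [-EReal.coe_sub]
  | top => simp
  | coe m => rw [← EReal.coe_sub, EReal.coe_le_coe_iff, EReal.coe_le_coe_iff, sub_le_comm]

theorem negLegendre_rooftopEnvelope_le_coe_iff {s : ℝ} {x : EuclideanSpace ℝ (Fin n)} :
    negLegendre (fun σ => rooftopEnvelope ψ₀ ψ₁ σ x) s ≤ b ↔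
      b ∈ upperBounds (minorantValues ψ₀ ψ₁ (s, x)) := by
  have hdual : negLegendre (fun σ => rooftopEnvelope ψ₀ ψ₁ σ x) s ≤ b ↔ ∀ q : ℝ × _,
      ((inner ℝ q.2 x - (b - s * q.1) : ℝ) : EReal) ≤
        legendre (fun x => ((min (ψ₀ x) (ψ₁ x - q.1) : ℝ) : EReal)) q.2 := by
    simp only [← coe_sub_le_coe_iff, Prod.forall]
    refine iSup_le_iff.trans (forall_congr' fun σ => ?_)
    rw [← EReal.le_sub_iff_add_le (by simp) (by simp), ← EReal.coe_sub]
    exact iSup_le_iff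
  rw [hdual]
  constructor
  · rintro h _ ⟨a, q, hq, rfl⟩
    have hle := EReal.coe_le_coe_iff.1 ((h q).trans (isAffineMinorant_iff_legendre_min_le.1 hq))
    rw [pairing_apply]
    linarith
  · refine fun h q => EReal.le_of_forall_lt_iff_le.1 fun c hc => EReal.coe_le_coe_iff.2 ?_
    have hle := h ⟨-c, q, isAffineMinorant_iff_legendre_min_le.2 (by simpa using hc.le), rfl⟩
    rw [pairing_apply] at hle
    linarith

theorem coe_eq_negLegendre_rooftopEnvelope {s r : ℝ} {x : EuclideanSpace ℝ (Fin n)}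
    (h : IsLUB (minorantValues ψ₀ ψ₁ (s, x)) r) :
    (r : EReal) = negLegendre (fun σ => rooftopEnvelope ψ₀ ψ₁ σ x) s := by
  refine le_antisymm (EReal.le_of_forall_lt_iff_le.1 fun b hb => EReal.coe_le_coe_iff.2 ?_)
    (negLegendre_rooftopEnvelope_le_coe_iff.2 h.1)
  exact h.2 (negLegendre_rooftopEnvelope_le_coe_iff.1 hb.le)

theorem IsAffineMinorant.legendre_left_eq (h : IsAffineMinorant ψ₀ ψ₁ a q) (hp : p.1 < 1)
    (htouch : a + pairing q p ∈ upperBounds (minorantValues ψ₀ ψ₁ p)) :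
    legendre (fun x => (ψ₀ x : EReal)) q.2 = (-a : ℝ) := by
  refine le_antisymm (legendre_coe_le_coe_iff.2 fun x => by linarith [h.left x])
    (EReal.le_of_forall_lt_iff_le.1 fun c hc => EReal.coe_le_coe_iff.2 ?_)
  have hc' := legendre_coe_le_coe_iff.1 hc.le
  -- Tilt the minorant about its trace on `{1} × ℝⁿ` until its constant term is `-c`.
  have hval := htouch ⟨-c, (q.1 + a + c, q.2),
    ⟨fun x => by linarith [hc' x], fun x => by linarith [h.right x]⟩, rfl⟩
  simp only [pairing_apply] at hval
  nlinarith

theorem IsAffineMinorant.legendre_right_eq (h : IsAffineMinorant ψ₀ ψ₁ a q) (hp : 0 < p.1)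
    (htouch : a + pairing q p ∈ upperBounds (minorantValues ψ₀ ψ₁ p)) :
    legendre (fun x => (ψ₁ x : EReal)) q.2 = (-(a + q.1) : ℝ) := by
  refine h.swap.legendre_left_eq (p := (1 - p.1, p.2)) (sub_lt_self 1 hp) ?_
  rw [minorantValues_swap]
  convert htouch using 1
  simp only [pairing_apply]
  ring

end Legendre

section MinorantEnvelope

variable {E : Type*} [NormedAddCommGroup E] [InnerProductSpace ℝ E] {ψ₀ ψ₁ : E → ℝ} {C : ℝ}
  {p : ℝ × E}

/-- The largest function on `[0, 1] × E` that is a supremum of affine functions lying below the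
boundary data `ψ₀` and `ψ₁`: the candidate solution. -/
noncomputable def minorantEnvelope (ψ₀ ψ₁ : E → ℝ) (p : ℝ × E) : ℝ :=
  sSup (minorantValues ψ₀ ψ₁ p)

theorem minorantEnvelope_swap (s : ℝ) (x : E) :
    minorantEnvelope ψ₁ ψ₀ (1 - s, x) = minorantEnvelope ψ₀ ψ₁ (s, x) := by
  rw [minorantEnvelope, minorantValues_swap, minorantEnvelope]

variable [FiniteDimensional ℝ E]

section LeftBound

variable (h₀ : ConvexOn ℝ univ ψ₀) (hC : ∀ x, ψ₀ x - ψ₁ x ≤ C)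
include h₀ hC

theorem isLUB_minorantEnvelope (hp : p ∈ Icc 0 1 ×ˢ univ) :
    IsLUB (minorantValues ψ₀ ψ₁ p) (minorantEnvelope ψ₀ ψ₁ p) := by
  refine isLUB_csSup ⟨_, sub_mul_mem_minorantValues h₀ hC (sub_one_lt (ψ₀ p.2)) p.1⟩
    ⟨(1 - p.1) * ψ₀ p.2 + p.1 * ψ₁ p.2, ?_⟩
  rintro _ ⟨a, q, h, rfl⟩
  exact h.le_chord hp.1 p.2

theorem minorantEnvelope_le_chord {s : ℝ} (hs : s ∈ Icc 0 1) (x : E) :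
    minorantEnvelope ψ₀ ψ₁ (s, x) ≤ (1 - s) * ψ₀ x + s * ψ₁ x := by
  refine (isLUB_minorantEnvelope h₀ hC (p := (s, x)) ⟨hs, trivial⟩).2 ?_
  rintro _ ⟨a, q, h, rfl⟩
  exact h.le_chord hs x

theorem sub_mul_le_minorantEnvelope {s : ℝ} (hs : s ∈ Icc 0 1) (x : E) :
    ψ₀ x - s * C ≤ minorantEnvelope ψ₀ ψ₁ (s, x) := by
  rw [sub_le_iff_le_add]
  refine le_of_forall_lt_imp_le_of_dense fun r hr => ?_
  rw [← sub_le_iff_le_add]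
  exact (isLUB_minorantEnvelope h₀ hC (p := (s, x)) ⟨hs, trivial⟩).1
    (sub_mul_mem_minorantValues h₀ hC hr s)

theorem convexOn_minorantEnvelope :
    ConvexOn ℝ (Icc 0 1 ×ˢ univ) (minorantEnvelope ψ₀ ψ₁) := by
  have hconvex : Convex ℝ (Icc (0 : ℝ) 1 ×ˢ (univ : Set E)) := (convex_Icc 0 1).prod convex_univ
  refine ⟨hconvex, fun p hp p' hp' s t hs ht hst => ?_⟩
  refine (isLUB_minorantEnvelope h₀ hC (hconvex hp hp' hs ht hst)).2 ?_
  rintro _ ⟨a, q, h, rfl⟩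
  calc a + pairing q (s • p + t • p') = s * (a + pairing q p) + t * (a + pairing q p') := by
        simp only [map_add, map_smul, smul_eq_mul]
        linear_combination -a * hst
    _ ≤ s * minorantEnvelope ψ₀ ψ₁ p + t * minorantEnvelope ψ₀ ψ₁ p' := by
        gcongr
        · exact (isLUB_minorantEnvelope h₀ hC hp).1 ⟨a, q, h, rfl⟩
        · exact (isLUB_minorantEnvelope h₀ hC hp').1 ⟨a, q, h, rfl⟩

theorem minorantEnvelope_zero (x : E) : minorantEnvelope ψ₀ ψ₁ (0, x) = ψ₀ x :=
  le_antisymm (by simpa using minorantEnvelope_le_chord h₀ hC (s := 0) (by simp) x)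
    (by simpa using sub_mul_le_minorantEnvelope h₀ hC (s := 0) (by simp) x)

theorem continuousWithinAt_minorantEnvelope_zero (x : E) :
    ContinuousWithinAt (fun s => minorantEnvelope ψ₀ ψ₁ (s, x)) (Ici 0) 0 := by
  rw [← continuousWithinAt_Icc_iff_Ici one_pos, ContinuousWithinAt, minorantEnvelope_zero h₀ hC]
  refine tendsto_of_tendsto_of_tendsto_of_le_of_le'
    (g := fun s => ψ₀ x - s * C) (h := fun s => (1 - s) * ψ₀ x + s * ψ₁ x)
    (tendsto_nhdsWithin_of_tendsto_nhds (Continuous.tendsto' (by fun_prop) _ _ (by simp)))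
    (tendsto_nhdsWithin_of_tendsto_nhds (Continuous.tendsto' (by fun_prop) _ _ (by simp)))
    (eventually_mem_nhdsWithin.mono fun s hs => sub_mul_le_minorantEnvelope h₀ hC hs x)
    (eventually_mem_nhdsWithin.mono fun s hs => minorantEnvelope_le_chord h₀ hC hs x)

end LeftBound

theorem continuousOn_minorantEnvelope (h₀ : ConvexOn ℝ univ ψ₀) (h₁ : ConvexOn ℝ univ ψ₁)
    (hC : ∀ x, |ψ₀ x - ψ₁ x| ≤ C) (x : E) :
    ContinuousOn (fun s => minorantEnvelope ψ₀ ψ₁ (s, x)) (Icc 0 1) := by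
  have hle : ∀ x, ψ₀ x - ψ₁ x ≤ C := fun x => (abs_le.1 (hC x)).2
  have hge : ∀ x, ψ₁ x - ψ₀ x ≤ C := fun x => by linarith [(abs_le.1 (hC x)).1]
  have hconvex : ConvexOn ℝ (Icc 0 1) fun s => minorantEnvelope ψ₀ ψ₁ (s, x) :=
    ((convexOn_minorantEnvelope h₀ hle).comp_affineMap
      ((AffineMap.id ℝ ℝ).prod (AffineMap.const ℝ ℝ x))).subset (fun s hs => ⟨hs, trivial⟩)
      (convex_Icc 0 1)
  refine hconvex.continuousOn_Icc one_pos (continuousWithinAt_minorantEnvelope_zero h₀ hle x) ?_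
  simp only [← minorantEnvelope_swap (ψ₀ := ψ₀)]
  have hzero : ContinuousWithinAt (fun s => minorantEnvelope ψ₁ ψ₀ (s, x)) (Ici 0) (1 - 1) := by
    rw [sub_self]
    exact continuousWithinAt_minorantEnvelope_zero h₁ hge x
  exact hzero.comp (f := fun s : ℝ => 1 - s) (by fun_prop) fun s hs => sub_nonneg.2 (mem_Iic.1 hs)

theorem minorantEnvelope_one (h₁ : ConvexOn ℝ univ ψ₁) (hC : ∀ x, ψ₁ x - ψ₀ x ≤ C) (x : E) :
    minorantEnvelope ψ₀ ψ₁ (1, x) = ψ₁ x := by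
  rw [← minorantEnvelope_swap, sub_self, minorantEnvelope_zero h₁ hC]

end MinorantEnvelope

theorem volume_prod_graph_eq_zero {X : Type*} [MeasurableSpace X] (μ : Measure X) [SFinite μ]
    {g : X → ℝ} (hg : Measurable g) : (volume.prod μ) {q : ℝ × X | q.1 = g q.2} = 0 := by
  have hgraph : MeasurableSet {q : ℝ × X | q.1 = g q.2} :=
    measurableSet_eq_fun measurable_fst (hg.comp measurable_snd)
  rw [Measure.prod_apply_symm hgraph]
  simp [preimage]

section Existence

variable {n : ℕ} {ψ₀ ψ₁ : EuclideanSpace ℝ (Fin n) → ℝ} {C : ℝ}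
  {p q : ℝ × EuclideanSpace ℝ (Fin n)}

theorem fst_eq_of_mem_subdifferentialOn_minorantEnvelope (h₀ : ConvexOn ℝ univ ψ₀)
    (h₁ : ConvexOn ℝ univ ψ₁) (hC : ∀ x, |ψ₀ x - ψ₁ x| ≤ C) (hp : p ∈ openStrip n)
    (hq : q ∈ subdifferentialOn (openStrip n) (minorantEnvelope ψ₀ ψ₁) p) :
    q.1 = (legendre (fun x => (ψ₀ x : EReal)) q.2).toReal -
      (legendre (fun x => (ψ₁ x : EReal)) q.2).toReal := by
  have hle : ∀ x, ψ₀ x - ψ₁ x ≤ C := fun x => (abs_le.1 (hC x)).2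
  have hge : ∀ x, ψ₁ x - ψ₀ x ≤ C := fun x => by linarith [(abs_le.1 (hC x)).1]
  obtain ⟨a, ha⟩ : ∃ a, a + pairing q p = minorantEnvelope ψ₀ ψ₁ p := ⟨_, sub_add_cancel _ _⟩
  have hminorant : IsAffineMinorant ψ₀ ψ₁ a q := by
    simpa only [minorantEnvelope_zero h₀ hle, minorantEnvelope_one h₁ hge] using
      isAffineMinorant_of_forall_le (a := a) (q := q) (continuousOn_minorantEnvelope h₀ h₁ hC)
        fun p' hp' => by linarith [mem_subdifferentialOn_iff.1 hq p' hp']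
  have htouch : a + pairing q p ∈ upperBounds (minorantValues ψ₀ ψ₁ p) :=
    ha ▸ (isLUB_minorantEnvelope h₀ hle (prod_mono_left Ioo_subset_Icc_self hp)).1
  rw [hminorant.legendre_left_eq hp.1.2 htouch, hminorant.legendre_right_eq hp.1.1 htouch,
    EReal.toReal_coe, EReal.toReal_coe]
  ring

theorem isHRMASolution_minorantEnvelope (h₀ : ConvexOn ℝ univ ψ₀) (h₁ : ConvexOn ℝ univ ψ₁)
    (hC : ∀ x, |ψ₀ x - ψ₁ x| ≤ C) : IsHRMASolution ψ₀ ψ₁ (minorantEnvelope ψ₀ ψ₁) where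
  convexOn := convexOn_minorantEnvelope h₀ fun x => (abs_le.1 (hC x)).2
  mongeAmpere_eq_zero B _ hB := by
    refine measure_mono_null (iUnion₂_subset fun p hp q hq =>
      fst_eq_of_mem_subdifferentialOn_minorantEnvelope h₀ h₁ hC (hB hp) hq) ?_
    exact volume_prod_graph_eq_zero volume
      ((measurable_legendre_coe ψ₀).ereal_toReal.sub (measurable_legendre_coe ψ₁).ereal_toReal)
  continuousOn := continuousOn_minorantEnvelope h₀ h₁ hC
  left_endpoint := minorantEnvelope_zero h₀ fun x => (abs_le.1 (hC x)).2
  right_endpoint := minorantEnvelope_one h₁ fun x => by linarith [(abs_le.1 (hC x)).1]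

theorem abs_minorantEnvelope_sub_le (h₀ : ConvexOn ℝ univ ψ₀) (hC : ∀ x, |ψ₀ x - ψ₁ x| ≤ C)
    {s : ℝ} (hs : s ∈ Icc 0 1) (x : EuclideanSpace ℝ (Fin n)) :
    |minorantEnvelope ψ₀ ψ₁ (s, x) - ψ₀ x| ≤ C := by
  have hle : ∀ x, ψ₀ x - ψ₁ x ≤ C := fun x => (abs_le.1 (hC x)).2
  have hlower := sub_mul_le_minorantEnvelope h₀ hle hs x
  have hupper := minorantEnvelope_le_chord h₀ hle hs x
  have hsC : s * C ≤ C := mul_le_of_le_one_left ((abs_nonneg _).trans (hC x)) hs.2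
  have hdiff : s * (ψ₁ x - ψ₀ x) ≤ s * C :=
    mul_le_mul_of_nonneg_left (by linarith [(abs_le.1 (hC x)).1]) hs.1
  exact abs_le.2 ⟨by linarith, by linarith⟩

end Existence

theorem proposition2p3_general (n : ℕ) (ψω ψ₀ ψ₁ : EuclideanSpace ℝ (Fin n) → ℝ)
    (hω : GrowsLinearly ψω) (h₀ : ConvexOn ℝ univ ψ₀) (h₁ : ConvexOn ℝ univ ψ₁)
    (hb₀ : ∃ C : ℝ, ∀ x, |ψ₀ x - ψω x| ≤ C) (hb₁ : ∃ C : ℝ, ∀ x, |ψ₁ x - ψω x| ≤ C) :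
    (∃ ψ : ℝ × EuclideanSpace ℝ (Fin n) → ℝ, IsHRMASolution ψ₀ ψ₁ ψ ∧
      ∃ C : ℝ, ∀ s ∈ Icc (0 : ℝ) 1, ∀ x, |ψ (s, x) - ψω x| ≤ C) ∧
    (∀ ψ : ℝ × EuclideanSpace ℝ (Fin n) → ℝ, IsHRMASolution ψ₀ ψ₁ ψ →
      ∀ s ∈ Icc (0 : ℝ) 1, ∀ x,
        (ψ (s, x) : EReal) = negLegendre (fun σ => rooftopEnvelope ψ₀ ψ₁ σ x) s) := by
  obtain ⟨C₀, hC₀⟩ := hb₀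
  obtain ⟨C₁, hC₁⟩ := hb₁
  have hC : ∀ x, |ψ₀ x - ψ₁ x| ≤ C₀ + C₁ := fun x =>
    (abs_sub_le _ (ψω x) _).trans (add_le_add (hC₀ x) (abs_sub_comm (ψ₁ x) _ ▸ hC₁ x))
  refine ⟨⟨_, isHRMASolution_minorantEnvelope h₀ h₁ hC, C₀ + C₁ + C₀, fun s hs x => ?_⟩,
    fun ψ hψ s hs x => coe_eq_negLegendre_rooftopEnvelope ?_⟩
  · exact (abs_sub_le _ (ψ₀ x) _).trans
      (add_le_add (abs_minorantEnvelope_sub_le h₀ hC hs x) (hC₀ x))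
  · exact hψ.isLUB_minorantValues (hω.of_abs_sub_le hC₀) (fun x => (abs_le.1 (hC x)).2)
      ⟨hs, trivial⟩

theorem proposition2p3 (n : ℕ)
    (ψω ψ₀ ψ₁ : EuclideanSpace ℝ (Fin n) → ℝ)
    (hω : StrictConvexOn ℝ Set.univ ψω)
    (h₀ : ConvexOn ℝ Set.univ ψ₀) (h₁ : ConvexOn ℝ Set.univ ψ₁)
    (hb₀ : ∃ C : ℝ, ∀ x, |ψ₀ x - ψω x| ≤ C)
    (hb₁ : ∃ C : ℝ, ∀ x, |ψ₁ x - ψω x| ≤ C) :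
    (∃ ψ : ℝ × EuclideanSpace ℝ (Fin n) → ℝ, IsHRMASolution ψ₀ ψ₁ ψ ∧
      ∃ C : ℝ, ∀ s ∈ Set.Icc (0 : ℝ) 1, ∀ x, |ψ (s, x) - ψω x| ≤ C) ∧
    (∀ ψ : ℝ × EuclideanSpace ℝ (Fin n) → ℝ, IsHRMASolution ψ₀ ψ₁ ψ →
      ∀ s ∈ Set.Icc (0 : ℝ) 1, ∀ x,
        (ψ (s, x) : EReal) = negLegendre (fun σ => rooftopEnvelope ψ₀ ψ₁ σ x) s) :=
  proposition2p3_general n ψω ψ₀ ψ₁ (growsLinearly_of_strictConvexOn hω) h₀ h₁ hb₀ hb₁
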